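/- Let $n\in\{2,3\}$ and let $\Omega\subset\mathbb R^n$ be a bounded polyhedral domain (open, connected), let $\mathcal T^h$ be a face-to-face subdivision of $\overline\Omega$ into finitely many closed nondegenerate $n$-simplices, with $\Omega$ the interior of the union of the simplices, and let $r\ge 1$ be an integer. Write $(\cdot,\cdot)$ and $\|\cdot\|$ for the $L^2(\Omega)$ inner product and norm of scalar, vector and tensor fields, and put $$V=\{v\in H^1_0(\Omega)^n:\operatorname{div}v=0\}.$$ Finite element spaces: $X_h^{(d)}$ is the space of (discontinuous) piecewise polynomials of degree at most $d$ on $\mathcal T^h$; $U_h=H^1(\Omega)\cap X_h^{(r)}$; $U_{h,0}=U_h\cap H^1_0(\Omega)$; $V_h=\{v_h\in U_{h,0}^n:\operatorname{div}v_h=0\}\subset V$ is the conforming Scott–Vogelius space; $RT_h$ is the space of all $p\in H(\operatorname{div};\Omega)$ with $p|_K=a_K+b_K x$, $a_K\in P^{r-1}(K)^n$, $b_K\in P^{r-1}(K)$, for every $K\in\mathcal T^h$. Put $\mathbf X_h=(X_h^{(r-1)})^n$ and $\mathbf{RT}_h=(RT_h)^n$ (tensor fields with rows in $RT_h$, on which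 $\operatorname{div}$ acts row by row). Constants: let $C_{0,h}$ be the smallest constant with $\|u-\pi_hu\|\le C_{0,h}\|\nabla u\|$ for all $u\in V$, where $\pi_h$ is the $L^2$-orthogonal projection onto $\mathbf X_h$; let $$\kappa_h=\sup_{0\ne f_h\in\mathbf X_h}\ \inf_{p_h,\,v_h}\frac{\|p_h-\nabla v_h\|}{\|f_h\|},$$ where the infimum is over $v_h\in V_h$ and over those $p_h\in\mathbf{RT}_h$ for which $\operatorname{div}p_h+\nabla\phi_h+f_h=0$ for some $\phi_h\in U_h$; and let $C_h=\sqrt{C_{0,h}^2+\kappa_h^2}$ (all taken in $[0,\infty]$). Eigenvalues: let $\lambda_1\le\lambda_2\le\cdots$ be the eigenvalues, counted with multiplicity, of the Stokes eigenvalue problem: find $\lambda\in\mathbb R$ and $0\ne u\in V$ with $(\nabla u,\nabla v)=\lambda(u,v)$ for all $v\in V$; and let $\lambda_{h,1}\le\lambda_{h,2}\le\cdots$ be the eigenvalues, counted with multiplicity, of the same problem with $V_h$ in place of $V$. That is, the $k$-th eigenvalue is the least $s\ge 0$ for which there are $k$ linearly independent eigenfunctions with eigenvalues at most $s$. Theorem.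 For every $k=1,2,\dots,\dim V_h$ the eigenvalue $\lambda_{h,k}$ exists (is finite) and $$\lambda_k\ \ge\ \frac{\lambda_{h,k}}{1+C_h^2\,\lambda_{h,k}}.$$ -/

import Mathlib

open MeasureTheory
open scoped ENNReal NNReal ContDiff InnerProductSpace

namespace StokesFEM

noncomputable section

/-- The Euclidean space `ℝⁿ`. -/
abbrev Euc (n : ℕ) : Type := EuclideanSpace ℝ (Fin n)

/-- The scalar space `L²(Ω)`. -/
abbrev L2 {n : ℕ} (Ω : Set (Euc n)) : Type := Lp ℝ 2 (volume.restrict Ω)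

/-- The space `L²(Ω)ⁿ` of vector fields, with the norm `‖u‖² = ∑ᵢ ‖uᵢ‖²`. -/
abbrev L2Vec {n : ℕ} (Ω : Set (Euc n)) : Type := PiLp 2 (fun _ : Fin n => L2 Ω)

/-- The space `L²(Ω)ⁿˣⁿ` of tensor fields, with the norm `‖p‖² = ∑ᵢⱼ ‖pᵢⱼ‖²`; `p i` is the `i`-th
row of `p`. -/
abbrev L2Ten {n : ℕ} (Ω : Set (Euc n)) : Type := PiLp 2 (fun _ : Fin n => L2Vec Ω)

/-- The classical partial derivative `∂φ/∂xᵢ`. -/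
def partialDeriv {n : ℕ} (i : Fin n) (φ : Euc n → ℝ) (x : Euc n) : ℝ :=
  fderiv ℝ φ x (EuclideanSpace.single i 1)

/-- `φ ∈ C_c^∞(Ω)`. -/
structure IsTest {n : ℕ} (Ω : Set (Euc n)) (φ : Euc n → ℝ) : Prop where
  smooth : ContDiff ℝ ∞ φ
  compact : HasCompactSupport φ
  support : tsupport φ ⊆ Ω

/-- `g ∈ L²(Ω)` is the weak partial derivative `∂ᵢ u` of `u ∈ L²(Ω)`. -/
def IsWeakPartial {n : ℕ} (Ω : Set (Euc n)) (i : Fin n) (u g : L2 Ω) : Prop :=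
  ∀ φ : Euc n → ℝ, IsTest Ω φ →
    ∫ x in Ω, u x * partialDeriv i φ x = - ∫ x in Ω, g x * φ x

/-- `g ∈ L²(Ω)` is the weak divergence of the vector field `p ∈ L²(Ω)ⁿ`. -/
def IsWeakDiv {n : ℕ} (Ω : Set (Euc n)) (p : L2Vec Ω) (g : L2 Ω) : Prop :=
  ∀ φ : Euc n → ℝ, IsTest Ω φ →
    ∑ i, ∫ x in Ω, p i x * partialDeriv i φ x = - ∫ x in Ω, g x * φ x

section Helpers

variable {n : ℕ} {Ω : Set (Euc n)}

theorem IsTest.zero : IsTest Ω (0 : Euc n → ℝ) :=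
  ⟨contDiff_const, HasCompactSupport.zero, by simp [tsupport]⟩

theorem IsTest.add {φ ψ : Euc n → ℝ} (hφ : IsTest Ω φ) (hψ : IsTest Ω ψ) : IsTest Ω (φ + ψ) :=
  ⟨hφ.smooth.add hψ.smooth, hφ.compact.add hψ.compact,
    (tsupport_add φ ψ).trans (Set.union_subset hφ.support hψ.support)⟩

theorem IsTest.smul {φ : Euc n → ℝ} (c : ℝ) (hφ : IsTest Ω φ) : IsTest Ω (c • φ) :=
  ⟨contDiff_const.smul hφ.smooth, hφ.compact.smul_left (f := fun _ => c),
    (tsupport_smul_subset_right (fun _ => c) φ).trans hφ.support⟩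

theorem IsTest.differentiableAt {φ : Euc n → ℝ} (hφ : IsTest Ω φ) (x : Euc n) :
    DifferentiableAt ℝ φ x :=
  (hφ.smooth.differentiable (by simp)).differentiableAt

theorem partialDeriv_zero (i : Fin n) (x : Euc n) :
    partialDeriv i (0 : Euc n → ℝ) x = 0 := by
  simp [partialDeriv]

theorem partialDeriv_add (i : Fin n) {φ ψ : Euc n → ℝ} (hφ : IsTest Ω φ) (hψ : IsTest Ω ψ)
    (x : Euc n) : partialDeriv i (φ + ψ) x = partialDeriv i φ x + partialDeriv i ψ x := by
  simp [partialDeriv, fderiv_add (hφ.differentiableAt x) (hψ.differentiableAt x)]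

theorem partialDeriv_smul (i : Fin n) (c : ℝ) {φ : Euc n → ℝ} (hφ : IsTest Ω φ)
    (x : Euc n) : partialDeriv i (c • φ) x = c * partialDeriv i φ x := by
  simp [partialDeriv, fderiv_const_smul (hφ.differentiableAt x)]

theorem integrable_mul_of_cc (u : L2 Ω) {ψ : Euc n → ℝ} (hc : Continuous ψ)
    (hs : HasCompactSupport ψ) : Integrable (fun x => u x * ψ x) (volume.restrict Ω) :=
  MemLp.integrable_mul (p := 2) (q := 2) (Lp.memLp u) (hc.memLp_of_hasCompactSupport hs)

theorem IsTest.integrable_mul {φ : Euc n → ℝ} (hφ : IsTest Ω φ) (u : L2 Ω) :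
    Integrable (fun x => u x * φ x) (volume.restrict Ω) :=
  integrable_mul_of_cc u hφ.smooth.continuous hφ.compact

theorem IsTest.integrable_mul_partialDeriv {φ : Euc n → ℝ} (hφ : IsTest Ω φ) (i : Fin n)
    (u : L2 Ω) : Integrable (fun x => u x * partialDeriv i φ x) (volume.restrict Ω) := by
  refine integrable_mul_of_cc u ?_ ?_
  · exact (hφ.smooth.continuous_fderiv (by simp)).clm_apply continuous_const
  · exact (hφ.compact.fderiv (𝕜 := ℝ)).comp_left (g := fun L : Euc n →L[ℝ] ℝ =>
      L (EuclideanSpace.single i 1)) rfl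

theorem integral_zero_mul (ψ : Euc n → ℝ) : ∫ x in Ω, (0 : L2 Ω) x * ψ x = 0 := by
  have h : (fun x => (0 : L2 Ω) x * ψ x) =ᵐ[volume.restrict Ω] fun _ => 0 := by
    filter_upwards [Lp.coeFn_zero ℝ 2 (volume.restrict Ω)] with x hx
    rw [hx, Pi.zero_apply, zero_mul]
  rw [integral_congr_ae h, integral_zero]

theorem integral_add_mul {u v : L2 Ω} {ψ : Euc n → ℝ}
    (hu : Integrable (fun x => u x * ψ x) (volume.restrict Ω))
    (hv : Integrable (fun x => v x * ψ x) (volume.restrict Ω)) :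
    ∫ x in Ω, (u + v : L2 Ω) x * ψ x = (∫ x in Ω, u x * ψ x) + ∫ x in Ω, v x * ψ x := by
  rw [← integral_add hu hv]
  refine integral_congr_ae ?_
  filter_upwards [Lp.coeFn_add u v] with x hx
  rw [hx, Pi.add_apply, add_mul]

theorem integral_smul_mul (c : ℝ) (u : L2 Ω) (ψ : Euc n → ℝ) :
    ∫ x in Ω, (c • u : L2 Ω) x * ψ x = c * ∫ x in Ω, u x * ψ x := by
  rw [← integral_const_mul]
  refine integral_congr_ae ?_
  filter_upwards [Lp.coeFn_smul c u] with x hx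
  simp [hx, mul_assoc]

theorem IsWeakPartial.zero (i : Fin n) : IsWeakPartial Ω i 0 0 := fun φ _ => by
  rw [integral_zero_mul, integral_zero_mul, neg_zero]

theorem IsWeakPartial.add {i : Fin n} {u v g h : L2 Ω} (hu : IsWeakPartial Ω i u g)
    (hv : IsWeakPartial Ω i v h) : IsWeakPartial Ω i (u + v) (g + h) := fun φ hφ => by
  rw [integral_add_mul (hφ.integrable_mul_partialDeriv i u) (hφ.integrable_mul_partialDeriv i v),
    integral_add_mul (hφ.integrable_mul g) (hφ.integrable_mul h), hu φ hφ, hv φ hφ]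
  ring

theorem IsWeakPartial.smul {i : Fin n} {u g : L2 Ω} (c : ℝ) (hu : IsWeakPartial Ω i u g) :
    IsWeakPartial Ω i (c • u) (c • g) := fun φ hφ => by
  rw [integral_smul_mul, integral_smul_mul, hu φ hφ]
  ring

theorem IsWeakDiv.zero : IsWeakDiv Ω 0 0 := fun φ _ => by
  simp only [PiLp.zero_apply, integral_zero_mul]
  simp

theorem IsWeakDiv.add {p q : L2Vec Ω} {g h : L2 Ω} (hp : IsWeakDiv Ω p g)
    (hq : IsWeakDiv Ω q h) : IsWeakDiv Ω (p + q) (g + h) := fun φ hφ => by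
  have key : ∀ i, ∫ x in Ω, (p + q) i x * partialDeriv i φ x =
      (∫ x in Ω, p i x * partialDeriv i φ x) + ∫ x in Ω, q i x * partialDeriv i φ x := fun i => by
    rw [PiLp.add_apply]
    exact integral_add_mul (hφ.integrable_mul_partialDeriv i (p i))
      (hφ.integrable_mul_partialDeriv i (q i))
  simp only [key]
  rw [Finset.sum_add_distrib, hp φ hφ, hq φ hφ,
    integral_add_mul (hφ.integrable_mul g) (hφ.integrable_mul h)]
  ring

theorem IsWeakDiv.smul {p : L2Vec Ω} {g : L2 Ω} (c : ℝ) (hp : IsWeakDiv Ω p g) :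
    IsWeakDiv Ω (c • p) (c • g) := fun φ hφ => by
  have key : ∀ i, ∫ x in Ω, (c • p) i x * partialDeriv i φ x =
      c * ∫ x in Ω, p i x * partialDeriv i φ x := fun i => by
    rw [PiLp.smul_apply]
    exact integral_smul_mul c (p i) _
  simp only [key]
  rw [← Finset.mul_sum, hp φ hφ, integral_smul_mul]
  ring

end Helpers

/-- The Sobolev space `H¹(Ω)`. -/
def H1 {n : ℕ} (Ω : Set (Euc n)) : Submodule ℝ (L2 Ω) where
  carrier := {u | ∀ i, ∃ g, IsWeakPartial Ω i u g}
  zero_mem' i := ⟨0, IsWeakPartial.zero i⟩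
  add_mem' hu hv i := by
    obtain ⟨g, hg⟩ := hu i
    obtain ⟨h, hh⟩ := hv i
    exact ⟨g + h, hg.add hh⟩
  smul_mem' c u hu i := by
    obtain ⟨g, hg⟩ := hu i
    exact ⟨c • g, hg.smul c⟩

/-- The graph `{(φ, ∇φ) : φ ∈ C_c^∞(Ω)}` in `L²(Ω) × L²(Ω)ⁿ`. -/
def testGraph {n : ℕ} (Ω : Set (Euc n)) : Submodule ℝ (L2 Ω × L2Vec Ω) where
  carrier := {z | ∃ φ, IsTest Ω φ ∧ z.1 =ᵐ[volume.restrict Ω] φ ∧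
    ∀ i, z.2 i =ᵐ[volume.restrict Ω] partialDeriv i φ}
  zero_mem' := by
    refine ⟨0, IsTest.zero, Lp.coeFn_zero _ _ _, fun i => ?_⟩
    filter_upwards [Lp.coeFn_zero ℝ 2 (volume.restrict Ω)] with x hx
    rw [partialDeriv_zero]
    simpa using hx
  add_mem' := by
    rintro z w ⟨φ, hφ, h1, h2⟩ ⟨ψ, hψ, k1, k2⟩
    refine ⟨φ + ψ, hφ.add hψ, ?_, fun i => ?_⟩
    · filter_upwards [Lp.coeFn_add z.1 w.1, h1, k1] with x hx hx1 hx2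
      rw [Prod.fst_add, hx, Pi.add_apply, Pi.add_apply, hx1, hx2]
    · filter_upwards [Lp.coeFn_add (z.2 i) (w.2 i), h2 i, k2 i] with x hx hx1 hx2
      rw [Prod.snd_add, PiLp.add_apply, hx, Pi.add_apply, hx1, hx2, partialDeriv_add i hφ hψ]
  smul_mem' := by
    rintro c z ⟨φ, hφ, h1, h2⟩
    refine ⟨c • φ, hφ.smul c, ?_, fun i => ?_⟩
    · filter_upwards [Lp.coeFn_smul c z.1, h1] with x hx hx1
      rw [Prod.smul_fst, hx, Pi.smul_apply, Pi.smul_apply, hx1]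
    · filter_upwards [Lp.coeFn_smul c (z.2 i), h2 i] with x hx hx1
      rw [Prod.smul_snd, PiLp.smul_apply, hx, Pi.smul_apply, hx1, partialDeriv_smul i c hφ,
        smul_eq_mul]

/-- The Sobolev space `H¹₀(Ω)`, the closure of `C_c^∞(Ω)` in the `H¹` norm: `u ∈ H¹₀(Ω)` if there
are `φₘ ∈ C_c^∞(Ω)` with `φₘ → u` and `∇φₘ` convergent (then to the weak gradient of `u`)
in `L²`. -/
def H10 {n : ℕ} (Ω : Set (Euc n)) : Submodule ℝ (L2 Ω) :=
  (testGraph Ω).topologicalClosure.map (LinearMap.fst ℝ (L2 Ω) (L2Vec Ω))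

open Classical in
/-- The weak partial derivative `∂ᵢ u` of `u ∈ H¹(Ω)`. -/
def weakPartial {n : ℕ} (Ω : Set (Euc n)) (i : Fin n) (u : L2 Ω) : L2 Ω :=
  if h : ∃ g, IsWeakPartial Ω i u g then h.choose else 0

/-- The weak gradient of a scalar function `u ∈ H¹(Ω)`. -/
def grad {n : ℕ} (Ω : Set (Euc n)) (u : L2 Ω) : L2Vec Ω :=
  WithLp.toLp 2 (fun i => weakPartial Ω i u)

/-- The weak gradient of a vector field `u ∈ H¹(Ω)ⁿ`; its `i`-th row is `∇uᵢ`. -/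
def gradVec {n : ℕ} (Ω : Set (Euc n)) (u : L2Vec Ω) : L2Ten Ω :=
  WithLp.toLp 2 (fun i => grad Ω (u i))

/-- `Sⁿ`, the vector fields all of whose components lie in `S`. -/
def vec {n : ℕ} {Ω : Set (Euc n)} (S : Submodule ℝ (L2 Ω)) : Submodule ℝ (L2Vec Ω) where
  carrier := {u | ∀ i, u i ∈ S}
  zero_mem' _ := S.zero_mem
  add_mem' hu hv i := S.add_mem (hu i) (hv i)
  smul_mem' c _ hu i := S.smul_mem c (hu i)

/-- The vector fields in `L²(Ω)ⁿ` with weak divergence zero. -/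
def divFree {n : ℕ} (Ω : Set (Euc n)) : Submodule ℝ (L2Vec Ω) where
  carrier := {u | IsWeakDiv Ω u 0}
  zero_mem' := IsWeakDiv.zero
  add_mem' hu hv := by simpa using IsWeakDiv.add hu hv
  smul_mem' c _ hu := by simpa using IsWeakDiv.smul c hu

/-- `V = {v ∈ H¹₀(Ω)ⁿ : div v = 0}`. -/
def V {n : ℕ} (Ω : Set (Euc n)) : Submodule ℝ (L2Vec Ω) :=
  vec (H10 Ω) ⊓ divFree Ω

/-- `T` is a (face-to-face) subdivision of the polyhedral region `Ω` into finitely many closed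
nondegenerate `n`-simplices, namely the convex hulls of the faces of `T` with `n + 1` vertices. -/
structure IsMesh {n : ℕ} (Ω : Set (Euc n)) (T : Geometry.SimplicialComplex ℝ (Euc n)) :
    Prop where
  finite : T.faces.Finite
  pure : ∀ s ∈ T.faces, ∃ t ∈ T.faces, s ⊆ t ∧ t.card = n + 1
  closure_eq : closure Ω = T.space
  interior_eq : interior T.space = Ω

/-- The vertex sets of the elements (triangles, tetrahedra) `K` of the mesh. -/
def cells {n : ℕ} (T : Geometry.SimplicialComplex ℝ (Euc n)) : Set (Finset (Euc n)) :=
  {s | s ∈ T.faces ∧ s.card = n + 1}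

/-- `Pᵐ`, the polynomials in `n` variables of total degree at most `m`. -/
abbrev Poly (n m : ℕ) : Submodule ℝ (MvPolynomial (Fin n) ℝ) :=
  MvPolynomial.restrictTotalDegree (Fin n) ℝ m

/-- The value of a polynomial at a point of `ℝⁿ`. -/
def pval {n : ℕ} (q : MvPolynomial (Fin n) ℝ) (x : Euc n) : ℝ :=
  MvPolynomial.eval (fun i => x i) q

/-- `X_h^{(d)}`: piecewise polynomials of degree at most `d`, without continuity. -/
def Xh {n : ℕ} (Ω : Set (Euc n)) (T : Geometry.SimplicialComplex ℝ (Euc n)) (d : ℕ) :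
    Submodule ℝ (L2 Ω) where
  carrier := {u | ∀ s ∈ cells T, ∃ q ∈ Poly n d, ∀ᵐ x ∂volume.restrict Ω,
    x ∈ convexHull ℝ (s : Set (Euc n)) → u x = pval q x}
  zero_mem' s _ := by
    refine ⟨0, Submodule.zero_mem _, ?_⟩
    filter_upwards [Lp.coeFn_zero ℝ 2 (volume.restrict Ω)] with x hx _
    rw [hx, Pi.zero_apply, pval, map_zero]
  add_mem' := by
    intro u v hu hv s hs
    obtain ⟨q, hq, h1⟩ := hu s hs
    obtain ⟨r, hr, h2⟩ := hv s hs
    refine ⟨q + r, Submodule.add_mem _ hq hr, ?_⟩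
    filter_upwards [Lp.coeFn_add u v, h1, h2] with x hx hx1 hx2 hxs
    rw [hx, Pi.add_apply, hx1 hxs, hx2 hxs, pval, pval, pval, map_add]
  smul_mem' := by
    intro c u hu s hs
    obtain ⟨q, hq, h1⟩ := hu s hs
    refine ⟨c • q, Submodule.smul_mem _ c hq, ?_⟩
    filter_upwards [Lp.coeFn_smul c u, h1] with x hx hx1 hxs
    simp [hx, pval, hx1 hxs, MvPolynomial.smul_eval]

/-- `U_h^{(r)} = H¹(Ω) ∩ X_h^{(r)}`. -/
def Uh {n : ℕ} (Ω : Set (Euc n)) (T : Geometry.SimplicialComplex ℝ (Euc n)) (r : ℕ) :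
    Submodule ℝ (L2 Ω) :=
  H1 Ω ⊓ Xh Ω T r

/-- `U_{h,0}^{(r)}`: the functions in `U_h^{(r)}` that vanish on `∂Ω`, that is, lie in `H¹₀(Ω)`. -/
def Uh0 {n : ℕ} (Ω : Set (Euc n)) (T : Geometry.SimplicialComplex ℝ (Euc n)) (r : ℕ) :
    Submodule ℝ (L2 Ω) :=
  Uh Ω T r ⊓ H10 Ω

/-- The conforming Scott–Vogelius space `V_h^{(r)} = {v ∈ (U_{h,0}^{(r)})ⁿ : div v = 0}`. -/
def Vh {n : ℕ} (Ω : Set (Euc n)) (T : Geometry.SimplicialComplex ℝ (Euc n)) (r : ℕ) :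
    Submodule ℝ (L2Vec Ω) :=
  vec (Uh0 Ω T r) ⊓ divFree Ω

/-- The Raviart–Thomas space `RT_h^{(m)}`: the fields `p ∈ H(div; Ω)` with `p = a_K + b_K x` on each
element `K`, where `a_K ∈ Pᵐ(K)ⁿ` and `b_K ∈ Pᵐ(K)`. -/
def RTh {n : ℕ} (Ω : Set (Euc n)) (T : Geometry.SimplicialComplex ℝ (Euc n)) (m : ℕ) :
    Set (L2Vec Ω) :=
  {p | (∃ g, IsWeakDiv Ω p g) ∧
    ∀ s ∈ cells T, ∃ a : Fin n → MvPolynomial (Fin n) ℝ, ∃ b ∈ Poly n m, (∀ i, a i ∈ Poly n m) ∧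
      ∀ i, ∀ᵐ x ∂volume.restrict Ω, x ∈ convexHull ℝ (s : Set (Euc n)) →
        p i x = pval (a i) x + pval b x * x i}

/-- The tensor-valued Raviart–Thomas space: every row lies in `RT_h^{(m)}`. -/
def RThTen {n : ℕ} (Ω : Set (Euc n)) (T : Geometry.SimplicialComplex ℝ (Euc n)) (m : ℕ) :
    Set (L2Ten Ω) :=
  {p | ∀ i, p i ∈ RTh Ω T m}

/-- `div p + ∇φ + f = 0` for some `φ ∈ U_h^{(r)}`, with the divergence taken row by row. -/
def Equilibrated {n : ℕ} (Ω : Set (Euc n)) (T : Geometry.SimplicialComplex ℝ (Euc n)) (r : ℕ)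
    (p : L2Ten Ω) (f : L2Vec Ω) : Prop :=
  ∃ φ ∈ Uh Ω T r, ∃ g : L2Vec Ω, (∀ i, IsWeakDiv Ω (p i) (g i)) ∧ g + grad Ω φ + f = 0

/-- The quantity `κ_h = max_{f_h} min_{p_h, v_h} ‖p_h - ∇v_h‖ / ‖f_h‖` over nonzero
`f_h ∈ (X_h^{(r-1)})ⁿ`, over `p_h ∈ (RT_h^{(r-1)})ⁿ` with `div p_h + ∇φ_h + f_h = 0` for some
`φ_h ∈ U_h^{(r)}`, and over `v_h ∈ V_h^{(r)}`. -/
def kappa {n : ℕ} (Ω : Set (Euc n)) (T : Geometry.SimplicialComplex ℝ (Euc n)) (r : ℕ) : ℝ≥0∞ :=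
  ⨆ (f : L2Vec Ω) (_ : f ∈ vec (Xh Ω T (r - 1))) (_ : f ≠ 0),
    ⨅ (p : L2Ten Ω) (_ : p ∈ RThTen Ω T (r - 1)) (_ : Equilibrated Ω T r p f)
      (v : L2Vec Ω) (_ : v ∈ Vh Ω T r), ‖p - gradVec Ω v‖ₑ / ‖f‖ₑ

/-- `w` is the orthogonal projection of `u` onto the subspace `S` in `L²(Ω)ⁿ`. -/
def IsL2Proj {n : ℕ} {Ω : Set (Euc n)} (S : Submodule ℝ (L2Vec Ω)) (u w : L2Vec Ω) : Prop :=
  w ∈ S ∧ ∀ v ∈ S, ⟪u - w, v⟫_ℝ = 0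

/-- `C_{0,h}`: the best constant in `‖u - π_h u‖ ≤ C_{0,h} ‖∇u‖` for `u ∈ V`, where `π_h` is the
`L²` projection onto `(X_h^{(d)})ⁿ`. -/
def C0h {n : ℕ} (Ω : Set (Euc n)) (T : Geometry.SimplicialComplex ℝ (Euc n)) (d : ℕ) : ℝ≥0∞ :=
  sInf {C | ∀ u ∈ V Ω, ∀ w, IsL2Proj (vec (Xh Ω T d)) u w → ‖u - w‖ₑ ≤ C * ‖gradVec Ω u‖ₑ}

/-- `C_h = √(C_{0,h}² + κ_h²)`, with the degrees `d = m = r - 1`. -/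
def Ch {n : ℕ} (Ω : Set (Euc n)) (T : Geometry.SimplicialComplex ℝ (Euc n)) (r : ℕ) : ℝ≥0∞ :=
  (C0h Ω T (r - 1) ^ 2 + kappa Ω T r ^ 2) ^ (1 / 2 : ℝ)

/-- `u` is an eigenfunction, with eigenvalue `lam`, of the problem: find `0 ≠ u ∈ W` with
`(∇u, ∇v) = lam (u, v)` for all `v ∈ W`. -/
def IsEigenpair {n : ℕ} {Ω : Set (Euc n)} (W : Submodule ℝ (L2Vec Ω)) (lam : ℝ)
    (u : L2Vec Ω) : Prop :=
  u ∈ W ∧ u ≠ 0 ∧ ∀ v ∈ W, ⟪gradVec Ω u, gradVec Ω v⟫_ℝ = lam * ⟪u, v⟫_ℝ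

/-- The `k`-th eigenvalue (`k ≥ 1`, in increasing order, counted with multiplicity) of the Stokes
eigenvalue problem on `W`: the least `s` such that there are `k` linearly independent
eigenfunctions with eigenvalues at most `s`. It is `⊤` if there are fewer than `k` eigenvalues. -/
def eigenvalue {n : ℕ} {Ω : Set (Euc n)} (W : Submodule ℝ (L2Vec Ω)) (k : ℕ) : ℝ≥0∞ :=
  ⨅ (s : ℝ≥0) (_ : ∃ u : Fin k → L2Vec Ω, LinearIndependent ℝ u ∧
    ∀ i, ∃ lam : ℝ, lam ≤ s ∧ IsEigenpair W lam (u i)), (s : ℝ≥0∞)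

end

end StokesFEM

/-! Let `P` be the energy projection of `V` onto `Vh`. The crux is the explicit a priori bound `‖e‖
≤ C_h ‖∇e‖` for every error `e = u - P u`, proved by duality in `norm_sq_le_of_energy_orthogonal`.
Let `z` be the Stokes flux with load `e` and `z'` the flux with load `π_h e`. Galerkin orthogonality
gives `‖e‖² = (z - ∇v_h, ∇e)` for every `v_h`. Here `‖z - z'‖ ≤ C_{0,h} ‖e - π_h e‖`, while the
Prager–Synge hypercircle bounds `‖z' - ∇v_h‖` by `‖p_h - ∇v_h‖` for an equilibrated `p_h`, hence by
about `κ_h ‖π_h e‖`. Cauchy–Schwarz in the plane combines the two constants.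

The eigenvalue bound then follows from a dimension count (`eigenvalue_comparison`). Among
combinations of `k` independent eigenfunctions with eigenvalues at most `s` there is some `w ≠ 0`
whose projection `P w` is orthogonal to the first `k - 1` discrete eigenvectors. With `ν` the `k`-th
discrete eigenvalue and `D = C_h²`, the bounds for `P w` and `w - P w` combine to `ν ‖w‖² ≤ (1 + D
ν) ‖∇w‖² ≤ (1 + D ν) s ‖w‖²`. This applies to every admissible `s`, so no spectral theory on `V` is
required. -/

namespace StokesFEM

noncomputable section

/-! ### Abstract Hilbert space argument: duality estimate and eigenvalue comparison -/

section Abstract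

variable {H K : Type*} [NormedAddCommGroup H] [InnerProductSpace ℝ H]
  [NormedAddCommGroup K] [InnerProductSpace ℝ K]

/-- Riesz representation in the energy inner product, in the closure of the range of `G`. -/
theorem exists_energy_representative [CompleteSpace K] {V : Submodule ℝ H} (G : V →ₗ[ℝ] K)
    {C : ℝ} (hC : ∀ v : V, ‖v‖ ≤ C * ‖G v‖) (f : H) :
    ∃ z ∈ (LinearMap.range G).topologicalClosure, ∀ v : V, ⟪z, G v⟫_ℝ = ⟪f, (v : H)⟫_ℝ := by
  have hinj : Function.Injective G := by
    rw [← LinearMap.ker_eq_bot, LinearMap.ker_eq_bot']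
    intro v hv
    have := hC v
    rw [hv, norm_zero, mul_zero] at this
    exact norm_le_zero_iff.mp this
  let e := LinearEquiv.ofInjective G hinj
  have he : ∀ y : LinearMap.range G, G (e.symm y) = y := fun y => by
    rw [← LinearEquiv.ofInjective_apply (h := hinj)]
    exact congrArg Subtype.val (e.apply_symm_apply y)
  -- The functional `G v ↦ ⟪f, v⟫` is bounded by the Poincaré inequality `hC`. Extending it by
  -- Hahn–Banach and projecting its Riesz vector onto the closed range avoids proving that `V` is
  -- complete in the energy norm.
  let F : StrongDual ℝ (LinearMap.range G) :=
    LinearMap.mkContinuous ((innerₛₗ ℝ f) ∘ₗ V.subtype ∘ₗ e.symm.toLinearMap) (‖f‖ * C)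
      (fun y => by
        have h1 := hC (e.symm y)
        rw [he] at h1
        calc ‖⟪f, ((e.symm y : V) : H)⟫_ℝ‖ ≤ ‖f‖ * ‖((e.symm y : V) : H)‖ := norm_inner_le_norm _ _
          _ ≤ ‖f‖ * (C * ‖(y : K)‖) := mul_le_mul_of_nonneg_left h1 (norm_nonneg _)
          _ = ‖f‖ * C * ‖y‖ := by rw [mul_assoc]; rfl)
  obtain ⟨g, hg, -⟩ := exists_extension_norm_eq _ F
  let M := (LinearMap.range G).topologicalClosure
  have : CompleteSpace M := (LinearMap.range G).isClosed_topologicalClosure.completeSpace_coe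
  let z₀ := (InnerProductSpace.toDual ℝ K).symm g
  refine ⟨M.starProjection z₀, Submodule.starProjection_apply_mem _ _, fun v => ?_⟩
  have hv : G v ∈ LinearMap.range G := ⟨v, rfl⟩
  have h1 : ⟪z₀ - M.starProjection z₀, G v⟫_ℝ = 0 :=
    Submodule.starProjection_inner_eq_zero _ _
      ((LinearMap.range G).le_topologicalClosure hv)
  have h2 : ⟪z₀, G v⟫_ℝ = ⟪f, (v : H)⟫_ℝ := by
    rw [InnerProductSpace.toDual_symm_apply]
    refine (hg ⟨G v, hv⟩).trans ?_
    change ⟪f, ((e.symm ⟨G v, hv⟩ : V) : H)⟫_ℝ = _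
    rw [show e.symm ⟨G v, hv⟩ = v from hinj (he _)]
  rw [inner_sub_left, sub_eq_zero] at h1
  rw [← h1, h2]

/-- A vector in the closure of a subspace is bounded by its pairings with the subspace. -/
theorem norm_le_of_mem_closure_of_inner_le {S : Submodule ℝ K} {z : K}
    (hz : z ∈ S.topologicalClosure) {B : ℝ} (hB : 0 ≤ B)
    (h : ∀ y ∈ S, ⟪z, y⟫_ℝ ≤ B * ‖y‖) : ‖z‖ ≤ B := by
  have key : ∀ y ∈ S.topologicalClosure, ⟪z, y⟫_ℝ ≤ B * ‖y‖ := by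
    intro y hy
    have hcl : IsClosed {y : K | ⟪z, y⟫_ℝ ≤ B * ‖y‖} :=
      isClosed_le (by fun_prop) (by fun_prop)
    exact closure_minimal (fun y hy => h y hy) hcl hy
  have h1 := key z hz
  rw [real_inner_self_eq_norm_sq] at h1
  rcases eq_or_ne z 0 with rfl | h0
  · rwa [norm_zero]
  · have := norm_pos_iff.mpr h0
    nlinarith

/-- The hypercircle identity as an inequality. -/
theorem norm_sub_le_of_inner_eq {S : Submodule ℝ K} {z p w : K}
    (hz : z ∈ S.topologicalClosure) (hw : w ∈ S) (h : ∀ y ∈ S, ⟪p, y⟫_ℝ = ⟪z, y⟫_ℝ) :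
    ‖z - w‖ ≤ ‖p - w‖ := by
  have key : ∀ y ∈ S.topologicalClosure, ⟪p - z, y⟫_ℝ = 0 := by
    intro y hy
    have hcl : IsClosed {y : K | ⟪p - z, y⟫_ℝ = 0} :=
      isClosed_eq (by fun_prop) (by fun_prop)
    exact closure_minimal
      (fun y hy => by simp [inner_sub_left, h y hy]) hcl hy
  -- `z - w` lies in the closure, so `p - w = (p - z) + (z - w)` is an orthogonal splitting.
  have h1 := key (z - w) (Submodule.sub_mem _ hz (S.le_topologicalClosure hw))
  have h2 : ‖p - w‖ ^ 2 = ‖p - z‖ ^ 2 + ‖z - w‖ ^ 2 := by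
    rw [show p - w = (p - z) + (z - w) by abel, norm_add_sq_real, h1]
    ring
  nlinarith [norm_nonneg (p - w), norm_nonneg (z - w), sq_nonneg ‖p - z‖]


/-- The a priori error estimate `‖e‖ ≤ C ‖G e‖`, `C² = c² + κ²`, for errors `e` that are orthogonal
to `Vh` in the energy inner product. -/
theorem norm_sq_le_of_energy_orthogonal [CompleteSpace K] {V : Submodule ℝ H} (G : V →ₗ[ℝ] K)
    (Vh : Submodule ℝ V) (X : Submodule ℝ H) [X.HasOrthogonalProjection]
    {C : ℝ} (hC : ∀ v : V, ‖v‖ ≤ C * ‖G v‖)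
    {c : ℝ} (hc0 : 0 ≤ c) (hc : ∀ v : V, ‖(v : H) - X.starProjection v‖ ≤ c * ‖G v‖)
    {κ : ℝ} (hκ : ∀ f ∈ X, ∀ ε > 0, ∃ p : K, (∀ v : V, ⟪p, G v⟫_ℝ = ⟪f, (v : H)⟫_ℝ) ∧
      ∃ v ∈ Vh, ‖p - G v‖ ≤ (κ + ε) * ‖f‖)
    {e : V} (he : ∀ v ∈ Vh, ⟪G v, G e⟫_ℝ = 0) :
    ‖e‖ ^ 2 ≤ (c ^ 2 + κ ^ 2) * ‖G e‖ ^ 2 := by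
  set f : H := (e : H) with hf
  set f' : H := X.starProjection f with hf'
  have hf'X : f' ∈ X := Submodule.starProjection_apply_mem _ _
  obtain ⟨z, hz, hzv⟩ := exists_energy_representative G hC f
  obtain ⟨z', hz', hzv'⟩ := exists_energy_representative G hC f'
  have hperp : ∀ y ∈ X, ⟪f - f', y⟫_ℝ = 0 := fun y hy =>
    Submodule.starProjection_inner_eq_zero _ _ hy
  have hzz' : ‖z - z'‖ ≤ c * ‖f - f'‖ := by
    refine norm_le_of_mem_closure_of_inner_le (Submodule.sub_mem _ hz hz') (by positivity) ?_
    rintro _ ⟨v, rfl⟩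
    rw [inner_sub_left, hzv, hzv', ← inner_sub_left]
    -- As `f - f'` is orthogonal to `X`, the test function may be replaced by its projection error,
    -- which `hc` controls.
    have h1 : ⟪f - f', (v : H)⟫_ℝ = ⟪f - f', (v : H) - X.starProjection v⟫_ℝ := by
      rw [inner_sub_right, hperp _ (Submodule.starProjection_apply_mem _ _), sub_zero]
    rw [h1]
    calc _ ≤ ‖f - f'‖ * ‖(v : H) - X.starProjection v‖ := real_inner_le_norm _ _
      _ ≤ ‖f - f'‖ * (c * ‖G v‖) := mul_le_mul_of_nonneg_left (hc v) (norm_nonneg _)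
      _ = c * ‖f - f'‖ * ‖G v‖ := by ring
  -- The slack `ε` is there because `hκ` gives near-optimal pairs only; it tends to zero in `key'`.
  have key : ∀ ε > 0, ‖f‖ ^ 2 ≤ (c * ‖f - f'‖ + (κ + ε) * ‖f'‖) * ‖G e‖ := by
    intro ε hε
    obtain ⟨p, hp, v, hv, hpv⟩ := hκ f' hf'X ε hε
    have h2 : ‖z' - G v‖ ≤ ‖p - G v‖ := by
      refine norm_sub_le_of_inner_eq hz' ⟨v, rfl⟩ ?_
      rintro _ ⟨w, rfl⟩
      rw [hp, hzv']
    have h3 : ‖f‖ ^ 2 = ⟪z - G v, G e⟫_ℝ := by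
      rw [inner_sub_left, he v hv, sub_zero, hzv, real_inner_self_eq_norm_sq]
    rw [h3]
    refine (real_inner_le_norm _ _).trans (mul_le_mul_of_nonneg_right ?_ (norm_nonneg _))
    calc ‖z - G v‖ = ‖(z - z') + (z' - G v)‖ := by rw [sub_add_sub_cancel]
      _ ≤ ‖z - z'‖ + ‖z' - G v‖ := norm_add_le _ _
      _ ≤ _ := add_le_add hzz' (h2.trans hpv)
  have key' : ‖f‖ ^ 2 ≤ (c * ‖f - f'‖ + κ * ‖f'‖) * ‖G e‖ := by
    have hlim : Filter.Tendsto (fun ε : ℝ => (c * ‖f - f'‖ + (κ + ε) * ‖f'‖) * ‖G e‖)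
        (nhdsWithin 0 (Set.Ioi 0)) (nhds ((c * ‖f - f'‖ + (κ + 0) * ‖f'‖) * ‖G e‖)) :=
      (Continuous.tendsto (by fun_prop) 0).mono_left nhdsWithin_le_nhds
    rw [add_zero] at hlim
    exact ge_of_tendsto hlim (Filter.eventually_of_mem self_mem_nhdsWithin key)
  have hpyth : ‖f‖ ^ 2 = ‖f - f'‖ ^ 2 + ‖f'‖ ^ 2 := by
    have h4 := norm_add_sq_real (f - f') f'
    rw [sub_add_cancel, hperp f' hf'X] at h4
    linarith
  have hcs : (c * ‖f - f'‖ + κ * ‖f'‖) ^ 2 ≤ (c ^ 2 + κ ^ 2) * ‖f‖ ^ 2 := by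
    rw [hpyth]
    nlinarith [sq_nonneg (c * ‖f'‖ - κ * ‖f - f'‖)]
  change ‖f‖ ^ 2 ≤ _
  rcases eq_or_ne f 0 with h0 | h0
  · rw [h0, norm_zero, zero_pow two_ne_zero]
    positivity
  have hpos : 0 < ‖f‖ ^ 2 := by positivity
  -- Squaring allows one factor `‖f‖ ^ 2` to be cancelled.
  have h5 : (‖f‖ ^ 2) ^ 2 ≤ ((c ^ 2 + κ ^ 2) * ‖G e‖ ^ 2) * ‖f‖ ^ 2 :=
    calc (‖f‖ ^ 2) ^ 2 ≤ ((c * ‖f - f'‖ + κ * ‖f'‖) * ‖G e‖) ^ 2 :=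
          pow_le_pow_left₀ hpos.le key' 2
      _ = (c * ‖f - f'‖ + κ * ‖f'‖) ^ 2 * ‖G e‖ ^ 2 := by ring
      _ ≤ (c ^ 2 + κ ^ 2) * ‖f‖ ^ 2 * ‖G e‖ ^ 2 :=
          mul_le_mul_of_nonneg_right hcs (sq_nonneg _)
      _ = _ := by ring
  rw [sq (‖f‖ ^ 2)] at h5
  exact le_of_mul_le_mul_right h5 hpos

/-- Energy bound on the span of eigenfunctions with eigenvalues at most `s`. -/
theorem norm_sq_sum_eigenfunctions_le {V : Submodule ℝ H} (G : V →ₗ[ℝ] K) {ι : Type*} [Fintype ι]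
    {u : ι → V} {lam : ι → ℝ} {s : ℝ} (hs : ∀ i, lam i ≤ s)
    (hu : ∀ i v, ⟪G (u i), G v⟫_ℝ = lam i * ⟪(u i : H), (v : H)⟫_ℝ) (c : ι → ℝ) :
    ‖G (∑ i, c i • u i)‖ ^ 2 ≤ s * ‖∑ i, c i • u i‖ ^ 2 := by
  have horth : ∀ i j, lam i ≠ lam j → ⟪u i, u j⟫_ℝ = 0 := by
    intro i j hij
    have h1 := hu i (u j)
    have h2 := hu j (u i)
    rw [real_inner_comm, h1, real_inner_comm (u i : H)] at h2
    have h3 : (lam i - lam j) * ⟪u i, u j⟫_ℝ = 0 := by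
      rw [sub_mul]
      exact sub_eq_zero.mpr h2
    exact (mul_eq_zero.mp h3).resolve_left (sub_ne_zero.mpr hij)
  have h1 : ‖G (∑ i, c i • u i)‖ ^ 2 = ∑ i, ∑ j, c i * c j * lam i * ⟪u i, u j⟫_ℝ := by
    rw [← real_inner_self_eq_norm_sq, map_sum, sum_inner]
    refine Finset.sum_congr rfl fun i _ => ?_
    rw [inner_sum]
    refine Finset.sum_congr rfl fun j _ => ?_
    rw [map_smul, map_smul, real_inner_smul_left, real_inner_smul_right, hu]
    change _ = _ * ⟪(u i : H), (u j : H)⟫_ℝ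
    ring
  have h2 : ∀ d : ι → ℝ, ‖∑ i, d i • u i‖ ^ 2 = ∑ i, ∑ j, d i * d j * ⟪u i, u j⟫_ℝ := by
    intro d
    rw [← real_inner_self_eq_norm_sq, sum_inner]
    refine Finset.sum_congr rfl fun i _ => ?_
    rw [inner_sum]
    refine Finset.sum_congr rfl fun j _ => ?_
    rw [real_inner_smul_left, real_inner_smul_right]
    ring
  -- The `u i` need not be orthogonal, but terms with `lam i ≠ lam j` vanish by `horth`; in the
  -- others the two square roots multiply to `s - lam i`. The defect is thus a square.
  have h3 : s * ‖∑ i, c i • u i‖ ^ 2 - ‖G (∑ i, c i • u i)‖ ^ 2 =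
      ‖∑ i, (c i * √(s - lam i)) • u i‖ ^ 2 := by
    rw [h1, h2, h2, Finset.mul_sum, ← Finset.sum_sub_distrib]
    refine Finset.sum_congr rfl fun i _ => ?_
    rw [Finset.mul_sum, ← Finset.sum_sub_distrib]
    refine Finset.sum_congr rfl fun j _ => ?_
    rcases eq_or_ne (lam i) (lam j) with h | h
    · have h4 := Real.mul_self_sqrt (sub_nonneg.mpr (hs i))
      rw [← h]
      linear_combination (-(c i * c j * ⟪u i, u j⟫_ℝ)) * h4
    · rw [horth i j h]
      ring
  have := sq_nonneg ‖∑ i, (c i * √(s - lam i)) • u i‖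
  linarith

/-- The `k` smallest eigenvalues and eigenvectors of a symmetric form on a finite-dimensional
space, with the min-max bound on the complement of the first `k - 1` eigenvectors. -/
theorem exists_first_eigenvectors [CompleteSpace K] {W : Type*} [NormedAddCommGroup W]
    [InnerProductSpace ℝ W] [FiniteDimensional ℝ W] (G : W →ₗ[ℝ] K) {k : ℕ} (hk : 1 ≤ k)
    (hkn : k ≤ Module.finrank ℝ W) :
    ∃ (ν : ℝ) (e : Fin k → W) (lam : Fin k → ℝ), 0 ≤ ν ∧ Orthonormal ℝ e ∧ (∀ i, lam i ≤ ν) ∧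
      (∀ i v, ⟪G (e i), G v⟫_ℝ = lam i * ⟪e i, v⟫_ℝ) ∧
      ∀ v, (∀ i : Fin k, (i : ℕ) + 1 < k → ⟪e i, v⟫_ℝ = 0) → ν * ‖v‖ ^ 2 ≤ ‖G v‖ ^ 2 := by
  have : CompleteSpace W := FiniteDimensional.complete ℝ W
  let G' : W →L[ℝ] K := LinearMap.toContinuousLinearMap G
  -- The form `⟪G v, G w⟫` is represented by the symmetric operator `G* G`.
  let A : W →ₗ[ℝ] W := (ContinuousLinearMap.adjoint G' ∘L G').toLinearMap
  have hA : ∀ v w, ⟪A v, w⟫_ℝ = ⟪G v, G w⟫_ℝ := fun v w =>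
    ContinuousLinearMap.adjoint_inner_left G' w (G' v)
  have hsymm : A.IsSymmetric := fun v w => by
    rw [hA, real_inner_comm, real_inner_comm (A w), hA]
  let b := hsymm.eigenvectorBasis rfl
  let θ := hsymm.eigenvalues rfl
  have hθ : Antitone θ := hsymm.eigenvalues_antitone rfl
  have hb : ∀ j v, ⟪G (b j), G v⟫_ℝ = θ j * ⟪b j, v⟫_ℝ := fun j v => by
    rw [← hA, hsymm.apply_eigenvectorBasis rfl j, real_inner_smul_left]
    rfl
  have hθ0 : ∀ j, 0 ≤ θ j := fun j => by
    have := hb j (b j)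
    rw [real_inner_self_eq_norm_sq, real_inner_self_eq_norm_sq, b.norm_eq_one] at this
    nlinarith [sq_nonneg ‖G (b j)‖]
  -- `hsymm.eigenvalues` is decreasing, so the index is reversed to pick the `k` smallest
  -- eigenvalues.
  let φ : Fin k → Fin (Module.finrank ℝ W) := fun i => Fin.rev (Fin.castLE hkn i)
  have hφ : Function.Injective φ := fun i j h => by
    exact Fin.castLE_injective hkn (Fin.rev_injective h)
  let last : Fin k := ⟨k - 1, by omega⟩
  refine ⟨θ (φ last), b ∘ φ, θ ∘ φ, hθ0 _, b.orthonormal.comp φ hφ, fun i => hθ ?_,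
    fun i v => hb _ _, fun v hv => ?_⟩
  · simp only [φ, Fin.rev_le_rev]
    rw [Fin.le_def]
    simp only [Fin.val_castLE, last]
    omega
  · have h1 : ‖v‖ ^ 2 = ∑ j, ⟪b j, v⟫_ℝ ^ 2 := by
      rw [← b.sum_sq_norm_inner_right v]
      simp
    have h2 : ‖G v‖ ^ 2 = ∑ j, θ j * ⟪b j, v⟫_ℝ ^ 2 := by
      have h3 : ∀ w, ⟪G v, G w⟫_ℝ = ∑ j, ⟪b j, v⟫_ℝ * (θ j * ⟪b j, w⟫_ℝ) := fun w => by
        conv_lhs => rw [← b.sum_repr' v]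
        rw [map_sum, sum_inner]
        refine Finset.sum_congr rfl fun j _ => ?_
        rw [map_smul, real_inner_smul_left, hb]
      rw [← real_inner_self_eq_norm_sq, h3]
      exact Finset.sum_congr rfl fun j _ => by ring
    rw [h1, h2, Finset.mul_sum]
    refine Finset.sum_le_sum fun j _ => ?_
    -- `Fin.rev j` is the rank of `θ j` from below, counted from zero: either `b j` is among the
    -- first `k - 1` eigenvectors and its coefficient vanishes, or `θ j` is at least the `k`-th
    -- eigenvalue.
    by_cases hj : (Fin.rev j : ℕ) + 1 < k
    · have h3 := hv ⟨Fin.rev j, by omega⟩ hj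
      have h4 : φ ⟨Fin.rev j, by omega⟩ = j := by
        simp only [φ]
        rw [Fin.rev_eq_iff]
        rfl
      rw [Function.comp_apply, h4] at h3
      simp [h3]
    · refine mul_le_mul_of_nonneg_right (hθ ?_) (sq_nonneg _)
      rw [Fin.le_def]
      simp only [φ, last, Fin.val_rev, Fin.val_castLE] at hj ⊢
      omega

/-- Comparison of the `k`-th eigenvalue of a form with that of its restriction to a
finite-dimensional subspace. -/
theorem eigenvalue_comparison [CompleteSpace K] {V : Submodule ℝ H} (G : V →ₗ[ℝ] K)
    (Vh : Submodule ℝ V) [FiniteDimensional ℝ Vh]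
    {C : ℝ} (hC : ∀ v : V, ‖v‖ ≤ C * ‖G v‖)
    {D : ℝ} (hD : 0 ≤ D) (he : ∀ e : V, (∀ v ∈ Vh, ⟪G v, G e⟫_ℝ = 0) → ‖e‖ ^ 2 ≤ D * ‖G e‖ ^ 2)
    {k : ℕ} (hk : 1 ≤ k) {ν : ℝ} (hν : 0 ≤ ν) {e : Fin k → Vh} (e0 : ∀ i, e i ≠ 0) {μ : Fin k → ℝ}
    (hμ : ∀ i (v : Vh), ⟪G (e i), G v⟫_ℝ = μ i * ⟪e i, v⟫_ℝ)
    (hmin : ∀ v : Vh, (∀ i : Fin k, (i : ℕ) + 1 < k → ⟪e i, v⟫_ℝ = 0) →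
      ν * ‖v‖ ^ 2 ≤ ‖G v‖ ^ 2)
    {u : Fin k → V} (hlin : LinearIndependent ℝ u) {lam : Fin k → ℝ} {s : ℝ} (hs : ∀ i, lam i ≤ s)
    (hu : ∀ i v, ⟪G (u i), G v⟫_ℝ = lam i * ⟪(u i : H), (v : H)⟫_ℝ) :
    ν ≤ s * (1 + D * ν) := by
  -- There are `k` coefficients and only `k - 1` conditions. They are imposed in the energy product,
  -- so that they pass from `w` to its energy projection `x`.
  let L : (Fin k → ℝ) →ₗ[ℝ] (Fin (k - 1) → ℝ) := LinearMap.pi fun i =>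
    (innerₛₗ ℝ (G (e ⟨i, by omega⟩))) ∘ₗ G ∘ₗ Fintype.linearCombination ℝ u
  obtain ⟨c, hcL, hc0⟩ := (Submodule.ne_bot_iff _).mp
    (LinearMap.ker_ne_bot_of_finrank_lt (f := L) (by simp; omega))
  have hL : ∀ i : Fin k, (i : ℕ) + 1 < k → ⟪G (e i), G (∑ i, c i • u i)⟫_ℝ = 0 := by
    intro i hi
    exact congrFun (LinearMap.mem_ker.mp hcL) ⟨i, by omega⟩
  set w : V := ∑ i, c i • u i with hw
  have hw0 : w ≠ 0 := fun h => hc0 (funext (Fintype.linearIndependent_iff.mp hlin c h))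
  have hbound : ‖G w‖ ^ 2 ≤ s * ‖w‖ ^ 2 := norm_sq_sum_eigenfunctions_le G hs hu c
  have : FiniteDimensional ℝ (Vh.map G) := inferInstance
  obtain ⟨x, hx, hxP⟩ : (Vh.map G).starProjection (G w) ∈ Vh.map G :=
    Submodule.starProjection_apply_mem _ _
  have hperp : ∀ v ∈ Vh, ⟪G v, G (w - x)⟫_ℝ = 0 := fun v hv => by
    rw [real_inner_comm, map_sub, hxP]
    exact Submodule.starProjection_inner_eq_zero _ _ ⟨v, hv, rfl⟩
  have hE := he (w - x) hperp
  -- Nonzero `μ i` make energy orthogonality to `e i` the same as `L²` orthogonality, as `hmin`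
  -- demands.
  have hμpos : ∀ i, μ i ≠ 0 := fun i h => by
    have h1 := hμ i (e i)
    rw [h, zero_mul, inner_self_eq_zero] at h1
    have h2 := hC (e i)
    rw [h1, norm_zero, mul_zero] at h2
    exact e0 i (Subtype.ext (norm_le_zero_iff.mp h2))
  have hx2 : ν * ‖x‖ ^ 2 ≤ ‖G x‖ ^ 2 := by
    refine hmin ⟨x, hx⟩ fun i hi => ?_
    have h1 := hμ i ⟨x, hx⟩
    have h2 := hperp _ (e i).2
    rw [map_sub, inner_sub_right, hL i hi, zero_sub, neg_eq_zero] at h2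
    rw [h2] at h1
    exact (mul_eq_zero.mp h1.symm).resolve_left (hμpos i)
  have hpyth : ‖G w‖ ^ 2 = ‖G x‖ ^ 2 + ‖G (w - x)‖ ^ 2 := by
    have h1 := norm_add_sq_real (G x) (G (w - x))
    rw [hperp x hx, ← map_add, add_sub_cancel] at h1
    linarith
  have htri : ‖w‖ ≤ ‖x‖ + ‖w - x‖ := by
    simpa using norm_add_le x (w - x)
  set a := ‖x‖
  set b := ‖w - x‖
  set A := ‖G x‖ ^ 2
  set B := ‖G (w - x)‖ ^ 2
  have ha : 0 ≤ a := norm_nonneg _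
  have hb : 0 ≤ b := norm_nonneg _
  have hA : 0 ≤ A := sq_nonneg _
  have hB : 0 ≤ B := sq_nonneg _
  -- `x` and `w - x` are not `L²`-orthogonal. The cross term is absorbed by the arithmetic–geometric
  -- mean inequality for `ν * D * A` and `B`.
  have hcross : 2 * (ν * a * b) ≤ ν * D * A + B := by
    refine abs_le_of_sq_le_sq' ?_ (by positivity) |>.2
    have h1 : (ν * a * b) ^ 2 ≤ ν * A * (D * B) :=
      calc (ν * a * b) ^ 2 = ν * (ν * a ^ 2) * b ^ 2 := by ring
        _ ≤ ν * A * (D * B) := by gcongr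
    nlinarith [sq_nonneg (ν * D * A - B)]
  have hfin : ν * ‖w‖ ^ 2 ≤ (1 + D * ν) * ‖G w‖ ^ 2 :=
    calc ν * ‖w‖ ^ 2 ≤ ν * (a + b) ^ 2 := by gcongr
      _ = ν * a ^ 2 + 2 * (ν * a * b) + ν * b ^ 2 := by ring
      _ ≤ A + (ν * D * A + B) + ν * (D * B) := by gcongr
      _ = (1 + D * ν) * ‖G w‖ ^ 2 := by rw [hpyth]; ring
  have hwpos : 0 < ‖w‖ ^ 2 := by positivity
  refine le_of_mul_le_mul_right ?_ hwpos
  calc ν * ‖w‖ ^ 2 ≤ (1 + D * ν) * ‖G w‖ ^ 2 := hfin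
    _ ≤ (1 + D * ν) * (s * ‖w‖ ^ 2) := by gcongr
    _ = _ := by ring

/-- A finite-dimensional subspace of dimension at least `k` carries `k` linearly independent
eigenvectors with eigenvalues at most some `ν`, where `ν / (1 + D ν)` is a lower bound for the
`k`-th eigenvalue on the whole space. -/
theorem exists_eigenvectors_and_lower_bound [CompleteSpace K] {V Vh : Submodule ℝ H}
    (hVh : Vh ≤ V) [FiniteDimensional ℝ Vh] (G : V →ₗ[ℝ] K)
    {C : ℝ} (hC : ∀ v : V, ‖v‖ ≤ C * ‖G v‖) {k : ℕ} (hk : 1 ≤ k)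
    (hkn : k ≤ Module.finrank ℝ Vh) :
    ∃ (ν : ℝ) (e : Fin k → Vh) (μ : Fin k → ℝ), 0 ≤ ν ∧
      LinearIndependent ℝ (fun i => (e i : H)) ∧ (∀ i, μ i ≤ ν) ∧
      (∀ i (v : Vh), ⟪G ⟨e i, hVh (e i).2⟩, G ⟨v, hVh v.2⟩⟫_ℝ = μ i * ⟪(e i : H), (v : H)⟫_ℝ) ∧
      ∀ D : ℝ, 0 ≤ D →
        (∀ e : V, (∀ v : Vh, ⟪G ⟨v, hVh v.2⟩, G e⟫_ℝ = 0) → ‖e‖ ^ 2 ≤ D * ‖G e‖ ^ 2) →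
        ∀ (u : Fin k → V) (lam : Fin k → ℝ) (s : ℝ), LinearIndependent ℝ (fun i => (u i : H)) →
        (∀ i, lam i ≤ s) →
        (∀ i (v : V), ⟪G (u i), G v⟫_ℝ = lam i * ⟪(u i : H), (v : H)⟫_ℝ) →
        ν ≤ s * (1 + D * ν) := by
  let W : Submodule ℝ V := Vh.submoduleOf V
  let eW : W ≃ₗ[ℝ] Vh := Submodule.submoduleOfEquivOfLe hVh
  have : FiniteDimensional ℝ W := eW.symm.finiteDimensional
  have hWk : k ≤ Module.finrank ℝ W := by rwa [eW.finrank_eq]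
  obtain ⟨ν, e, μ, hν, he, hμν, hμ, hmin⟩ :=
    exists_first_eigenvectors (W := W) (G ∘ₗ W.subtype) hk hWk
  refine ⟨ν, fun i => eW (e i), μ, hν, ?_, hμν, fun i v => hμ i (eW.symm v), ?_⟩
  · exact (he.linearIndependent.map' W.subtype W.ker_subtype).map' V.subtype V.ker_subtype
  · intro D hD herr u lam s hlin hs hu
    exact eigenvalue_comparison G W hC hD (fun e h => herr e fun v => h _ v.2) hk hν
      (fun i => he.ne_zero i) hμ hmin (LinearIndependent.of_comp V.subtype hlin) hs hu

end Abstract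

/-! ### Weak derivatives in Hilbert space form and integration by parts -/

section WeakDerivatives

variable {n : ℕ} {Ω : Set (Euc n)}

theorem L2.inner_eq_integral (u v : L2 Ω) : ⟪u, v⟫_ℝ = ∫ x in Ω, u x * v x := by
  rw [MeasureTheory.L2.inner_def]
  exact integral_congr_ae (.of_forall fun x => by simp [mul_comm])

theorem L2.inner_eq_integral_of_ae {u v : L2 Ω} {ψ : Euc n → ℝ}
    (h : v =ᵐ[volume.restrict Ω] ψ) : ⟪u, v⟫_ℝ = ∫ x in Ω, u x * ψ x := by
  rw [L2.inner_eq_integral]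
  exact integral_congr_ae (h.mono fun x hx => by simp only [hx])

theorem IsTest.continuous_partialDeriv {φ : Euc n → ℝ} (hφ : IsTest Ω φ) (i : Fin n) :
    Continuous (partialDeriv i φ) :=
  (hφ.smooth.continuous_fderiv (by simp)).clm_apply continuous_const

theorem IsTest.hasCompactSupport_partialDeriv {φ : Euc n → ℝ} (hφ : IsTest Ω φ) (i : Fin n) :
    HasCompactSupport (partialDeriv i φ) :=
  (hφ.compact.fderiv (𝕜 := ℝ)).comp_left (g := fun L : Euc n →L[ℝ] ℝ =>
    L (EuclideanSpace.single i 1)) rfl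

theorem IsTest.tsupport_partialDeriv_subset {φ : Euc n → ℝ} (hφ : IsTest Ω φ) (i : Fin n) :
    tsupport (partialDeriv i φ) ⊆ Ω := by
  refine (closure_mono ?_).trans ((tsupport_fderiv_subset ℝ).trans hφ.support)
  intro x hx h
  exact hx (by simp [partialDeriv, h])

/-- Every test function gives an element of `testGraph`. -/
theorem IsTest.exists_mem_testGraph {φ : Euc n → ℝ} (hφ : IsTest Ω φ) :
    ∃ z ∈ testGraph Ω, z.1 =ᵐ[volume.restrict Ω] φ ∧
      ∀ i, z.2 i =ᵐ[volume.restrict Ω] partialDeriv i φ := by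
  have h0 : MemLp φ 2 (volume.restrict Ω) :=
    hφ.smooth.continuous.memLp_of_hasCompactSupport hφ.compact
  have h1 : ∀ i, MemLp (partialDeriv i φ) 2 (volume.restrict Ω) := fun i =>
    (hφ.continuous_partialDeriv i).memLp_of_hasCompactSupport (hφ.hasCompactSupport_partialDeriv i)
  have h2 : h0.toLp φ =ᵐ[volume.restrict Ω] φ ∧
      ∀ i, (h1 i).toLp _ =ᵐ[volume.restrict Ω] partialDeriv i φ :=
    ⟨h0.coeFn_toLp, fun i => (h1 i).coeFn_toLp⟩
  exact ⟨(h0.toLp φ, WithLp.toLp 2 fun i => (h1 i).toLp _), ⟨φ, hφ, h2⟩, h2⟩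

/-- In terms of inner products the defining condition is continuous in all its arguments, so it
survives passage to closures. -/
theorem isWeakPartial_iff {i : Fin n} {u g : L2 Ω} :
    IsWeakPartial Ω i u g ↔ ∀ z ∈ testGraph Ω, ⟪u, z.2 i⟫_ℝ = -⟪g, z.1⟫_ℝ := by
  constructor
  · rintro h z ⟨φ, hφ, h1, h2⟩
    rw [L2.inner_eq_integral_of_ae h1, L2.inner_eq_integral_of_ae (h2 i), h φ hφ]
  · intro h φ hφ
    obtain ⟨z, hz, h1, h2⟩ := hφ.exists_mem_testGraph
    rw [← L2.inner_eq_integral_of_ae h1, ← L2.inner_eq_integral_of_ae (h2 i), h z hz]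

theorem isWeakDiv_iff {p : L2Vec Ω} {g : L2 Ω} :
    IsWeakDiv Ω p g ↔ ∀ z ∈ testGraph Ω, ⟪p, z.2⟫_ℝ = -⟪g, z.1⟫_ℝ := by
  constructor
  · rintro h z ⟨φ, hφ, h1, h2⟩
    rw [L2.inner_eq_integral_of_ae h1, PiLp.inner_apply, ← h φ hφ]
    exact Finset.sum_congr rfl fun i _ => L2.inner_eq_integral_of_ae (h2 i)
  · intro h φ hφ
    obtain ⟨z, hz, h1, h2⟩ := hφ.exists_mem_testGraph
    rw [← L2.inner_eq_integral_of_ae h1, ← h z hz, PiLp.inner_apply]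
    exact Finset.sum_congr rfl fun i _ => (L2.inner_eq_integral_of_ae (h2 i)).symm

theorem IsWeakPartial.inner_eq_of_mem_closure {i : Fin n} {u g : L2 Ω} (h : IsWeakPartial Ω i u g)
    {z : L2 Ω × L2Vec Ω} (hz : z ∈ (testGraph Ω).topologicalClosure) :
    ⟪u, z.2 i⟫_ℝ = -⟪g, z.1⟫_ℝ := by
  have hcl : IsClosed {z : L2 Ω × L2Vec Ω | ⟪u, z.2 i⟫_ℝ = -⟪g, z.1⟫_ℝ} :=
    isClosed_eq (by fun_prop) (by fun_prop)
  exact closure_minimal (fun z hz => isWeakPartial_iff.mp h z hz) hcl hz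

theorem IsWeakDiv.inner_eq_of_mem_closure {p : L2Vec Ω} {g : L2 Ω} (h : IsWeakDiv Ω p g)
    {z : L2 Ω × L2Vec Ω} (hz : z ∈ (testGraph Ω).topologicalClosure) :
    ⟪p, z.2⟫_ℝ = -⟪g, z.1⟫_ℝ := by
  have hcl : IsClosed {z : L2 Ω × L2Vec Ω | ⟪p, z.2⟫_ℝ = -⟪g, z.1⟫_ℝ} :=
    isClosed_eq (by fun_prop) (by fun_prop)
  exact closure_minimal (fun z hz => isWeakDiv_iff.mp h z hz) hcl hz

/-- An `L²` function that is orthogonal to all test functions vanishes. -/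
theorem eq_zero_of_inner_testGraph_eq_zero (hΩ : IsOpen Ω) {u : L2 Ω}
    (h : ∀ z ∈ testGraph Ω, ⟪u, z.1⟫_ℝ = 0) : u = 0 := by
  have h1 : ∀ᵐ x ∂volume.restrict Ω, x ∈ Ω → u x = 0 := by
    refine hΩ.ae_eq_zero_of_integral_contDiff_smul_eq_zero
      (((Lp.memLp u).locallyIntegrable (by norm_num)).locallyIntegrableOn Ω) ?_
    intro φ h1 h2 h3
    obtain ⟨z, hz, hz1, -⟩ := IsTest.exists_mem_testGraph (Ω := Ω) ⟨h1, h2, h3⟩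
    rw [← h z hz, L2.inner_eq_integral_of_ae hz1]
    simp only [smul_eq_mul, mul_comm]
  refine (Lp.eq_zero_iff_ae_eq_zero).mpr ?_
  filter_upwards [h1, ae_restrict_mem hΩ.measurableSet] with x hx hxΩ using hx hxΩ

theorem IsWeakPartial.unique (hΩ : IsOpen Ω) {i : Fin n} {u g g' : L2 Ω}
    (h : IsWeakPartial Ω i u g) (h' : IsWeakPartial Ω i u g') : g = g' := by
  refine sub_eq_zero.mp (eq_zero_of_inner_testGraph_eq_zero hΩ fun z hz => ?_)
  have h1 := isWeakPartial_iff.mp h z hz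
  have h2 := isWeakPartial_iff.mp h' z hz
  rw [inner_sub_left]
  linarith

theorem IsWeakDiv.unique (hΩ : IsOpen Ω) {p : L2Vec Ω} {g g' : L2 Ω}
    (h : IsWeakDiv Ω p g) (h' : IsWeakDiv Ω p g') : g = g' := by
  refine sub_eq_zero.mp (eq_zero_of_inner_testGraph_eq_zero hΩ fun z hz => ?_)
  have h1 := isWeakDiv_iff.mp h z hz
  have h2 := isWeakDiv_iff.mp h' z hz
  rw [inner_sub_left]
  linarith

theorem setIntegral_eq_integral_of_tsupport_subset {ψ : Euc n → ℝ} (h : tsupport ψ ⊆ Ω)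
    (θ : Euc n → ℝ) : ∫ x in Ω, θ x * ψ x = ∫ x, θ x * ψ x := by
  refine setIntegral_eq_integral_of_forall_compl_eq_zero fun x hx => ?_
  rw [image_eq_zero_of_notMem_tsupport fun h' => hx (h h'), mul_zero]

/-- Integration by parts for test functions. -/
theorem IsTest.integral_mul_partialDeriv {φ ψ : Euc n → ℝ} (hφ : IsTest Ω φ) (hψ : IsTest Ω ψ)
    (i : Fin n) :
    ∫ x in Ω, φ x * partialDeriv i ψ x = -∫ x in Ω, partialDeriv i φ x * ψ x := by
  rw [setIntegral_eq_integral_of_tsupport_subset (hψ.tsupport_partialDeriv_subset i),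
    setIntegral_eq_integral_of_tsupport_subset hψ.support]
  refine integral_mul_fderiv_eq_neg_fderiv_mul_of_integrable ?_ ?_ ?_
    (fun x _ => hφ.differentiableAt x) (fun x _ => hψ.differentiableAt x)
  · exact ((hφ.continuous_partialDeriv i).mul hψ.smooth.continuous).integrable_of_hasCompactSupport
      hψ.compact.mul_left
  · exact (hφ.smooth.continuous.mul (hψ.continuous_partialDeriv i)).integrable_of_hasCompactSupport
      (hψ.hasCompactSupport_partialDeriv i).mul_left
  · exact (hφ.smooth.continuous.mul hψ.smooth.continuous).integrable_of_hasCompactSupport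
      hψ.compact.mul_left

theorem isWeakPartial_of_mem_testGraph {z : L2 Ω × L2Vec Ω} (hz : z ∈ testGraph Ω) (i : Fin n) :
    IsWeakPartial Ω i z.1 (z.2 i) := by
  obtain ⟨φ, hφ, h1, h2⟩ := hz
  intro ψ hψ
  have h3 : ∫ x in Ω, z.1 x * partialDeriv i ψ x = ∫ x in Ω, φ x * partialDeriv i ψ x :=
    integral_congr_ae (h1.mono fun x hx => by simp only [hx])
  have h4 : ∫ x in Ω, z.2 i x * ψ x = ∫ x in Ω, partialDeriv i φ x * ψ x :=
    integral_congr_ae ((h2 i).mono fun x hx => by simp only [hx])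
  rw [h3, h4, hφ.integral_mul_partialDeriv hψ]

/-- The roles are exchanged: the test function `w.1` is the one differentiated weakly, and the limit
`z` is tested against it. -/
theorem isWeakPartial_of_mem_closure {z : L2 Ω × L2Vec Ω}
    (hz : z ∈ (testGraph Ω).topologicalClosure) (i : Fin n) : IsWeakPartial Ω i z.1 (z.2 i) := by
  refine isWeakPartial_iff.mpr fun w hw => ?_
  have h := (isWeakPartial_of_mem_testGraph hw i).inner_eq_of_mem_closure hz
  rw [real_inner_comm, real_inner_comm w.1]
  linarith

/-- Uniqueness makes the choice inside `weakPartial` harmless; linearity of the gradient rests on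
this. -/
theorem weakPartial_eq (hΩ : IsOpen Ω) {i : Fin n} {u g : L2 Ω} (h : IsWeakPartial Ω i u g) :
    weakPartial Ω i u = g := by
  have hex : ∃ g, IsWeakPartial Ω i u g := ⟨g, h⟩
  rw [weakPartial, dif_pos hex]
  exact hex.choose_spec.unique hΩ h

theorem isWeakPartial_weakPartial {i : Fin n} {u : L2 Ω} (hu : u ∈ H1 Ω) :
    IsWeakPartial Ω i u (weakPartial Ω i u) := by
  rw [weakPartial, dif_pos (hu i)]
  exact (hu i).choose_spec

theorem H10_le_H1 : H10 Ω ≤ H1 Ω := by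
  rintro _ ⟨z, hz, rfl⟩ i
  exact ⟨_, isWeakPartial_of_mem_closure hz i⟩

/-- The graph of the gradient on `H¹₀(Ω)` lies in the closure of the graph on test functions. -/
theorem mem_closure_testGraph_of_mem_H10 (hΩ : IsOpen Ω) {u : L2 Ω} (hu : u ∈ H10 Ω) :
    (u, grad Ω u) ∈ (testGraph Ω).topologicalClosure := by
  obtain ⟨z, hz, rfl⟩ := hu
  have h : grad Ω z.1 = z.2 := by
    ext1 i
    exact weakPartial_eq hΩ (isWeakPartial_of_mem_closure hz i)
  change (z.1, grad Ω z.1) ∈ _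
  rwa [h]

theorem grad_add (hΩ : IsOpen Ω) {u v : L2 Ω} (hu : u ∈ H1 Ω) (hv : v ∈ H1 Ω) :
    grad Ω (u + v) = grad Ω u + grad Ω v := by
  ext1 i
  exact weakPartial_eq hΩ ((isWeakPartial_weakPartial hu).add (isWeakPartial_weakPartial hv))

theorem grad_smul (hΩ : IsOpen Ω) (c : ℝ) {u : L2 Ω} (hu : u ∈ H1 Ω) :
    grad Ω (c • u) = c • grad Ω u := by
  ext1 i
  exact weakPartial_eq hΩ ((isWeakPartial_weakPartial hu).smul c)

/-- The gradient as a linear map on a subspace of `H¹(Ω)ⁿ`. -/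
def gradLin (hΩ : IsOpen Ω) (W : Submodule ℝ (L2Vec Ω)) (hW : W ≤ vec (H1 Ω)) :
    W →ₗ[ℝ] L2Ten Ω where
  toFun u := gradVec Ω u
  map_add' u v := by
    ext1 i
    exact grad_add hΩ (hW u.2 i) (hW v.2 i)
  map_smul' c u := by
    ext1 i
    exact grad_smul hΩ c (hW u.2 i)

theorem V_le_vec_H1 : V Ω ≤ vec (H1 Ω) := fun _ hu i => H10_le_H1 (hu.1 i)

theorem Vh_le_V (T : Geometry.SimplicialComplex ℝ (Euc n)) (r : ℕ) : Vh Ω T r ≤ V Ω :=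
  fun _ hu => ⟨fun i => (hu.1 i).2, hu.2⟩

/-- The weak divergence of `v ∈ H¹₀(Ω)ⁿ` is `∑ᵢ ∂ᵢvᵢ`. -/
theorem isWeakDiv_sum_weakPartial {v : L2Vec Ω} (hv : ∀ i, v i ∈ H1 Ω) :
    IsWeakDiv Ω v (∑ i, weakPartial Ω i (v i)) := by
  refine isWeakDiv_iff.mpr fun z hz => ?_
  rw [PiLp.inner_apply, sum_inner, ← Finset.sum_neg_distrib]
  exact Finset.sum_congr rfl fun i _ =>
    isWeakPartial_iff.mp (isWeakPartial_weakPartial (hv i)) z hz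

/-- Gradients are orthogonal to divergence-free fields in `H¹₀(Ω)ⁿ`. -/
theorem inner_grad_eq_zero (hΩ : IsOpen Ω) {φ : L2 Ω} (hφ : φ ∈ H1 Ω) {v : L2Vec Ω}
    (hv : v ∈ V Ω) : ⟪grad Ω φ, v⟫_ℝ = 0 := by
  have h0 : ∑ i, weakPartial Ω i (v i) = 0 :=
    (isWeakDiv_sum_weakPartial fun i => H10_le_H1 (hv.1 i)).unique hΩ hv.2
  have h1 : ∀ i, ⟪weakPartial Ω i φ, v i⟫_ℝ = -⟪φ, weakPartial Ω i (v i)⟫_ℝ := fun i => by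
    -- No boundary condition on `φ` is needed, since `v i` is a limit of test functions.
    have := (isWeakPartial_weakPartial (i := i) hφ).inner_eq_of_mem_closure
      (mem_closure_testGraph_of_mem_H10 hΩ (hv.1 i))
    change ⟪φ, weakPartial Ω i (v i)⟫_ℝ = _ at this
    rw [this, neg_neg]
  rw [PiLp.inner_apply]
  change ∑ i, ⟪weakPartial Ω i φ, v i⟫_ℝ = 0
  rw [Finset.sum_congr rfl fun i _ => h1 i, Finset.sum_neg_distrib, ← inner_sum, h0,
    inner_zero_right, neg_zero]

/-- An equilibrated tensor represents the load on divergence-free fields. -/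
theorem Equilibrated.inner_gradVec (hΩ : IsOpen Ω) {T : Geometry.SimplicialComplex ℝ (Euc n)}
    {r : ℕ} {p : L2Ten Ω} {f : L2Vec Ω} (h : Equilibrated Ω T r p f) {v : L2Vec Ω}
    (hv : v ∈ V Ω) : ⟪p, gradVec Ω v⟫_ℝ = ⟪f, v⟫_ℝ := by
  obtain ⟨φ, hφ, g, hg, hsum⟩ := h
  have h1 : ⟪p, gradVec Ω v⟫_ℝ = -⟪g, v⟫_ℝ := by
    rw [PiLp.inner_apply, PiLp.inner_apply, ← Finset.sum_neg_distrib]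
    exact Finset.sum_congr rfl fun i _ => (hg i).inner_eq_of_mem_closure
      (mem_closure_testGraph_of_mem_H10 hΩ (hv.1 i))
  have h2 : ⟪g + grad Ω φ + f, v⟫_ℝ = 0 := by rw [hsum, inner_zero_left]
  rw [inner_add_left, inner_add_left, inner_grad_eq_zero hΩ hφ.1 hv] at h2
  linarith

end WeakDerivatives

/-! ### Poincaré inequality -/

section Poincare

variable {n : ℕ} {Ω : Set (Euc n)}

theorem IsTest.coord_mul {φ : Euc n → ℝ} (hφ : IsTest Ω φ) (i : Fin n) :
    IsTest Ω (fun x => x i * φ x) where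
  smooth := ContDiff.mul (by fun_prop) hφ.smooth
  compact := hφ.compact.mul_left
  support := (tsupport_mul_subset_right (f := fun x : Euc n => x i)).trans hφ.support

theorem IsTest.partialDeriv_coord_mul {φ : Euc n → ℝ} (hφ : IsTest Ω φ) (i : Fin n) (x : Euc n) :
    partialDeriv i (fun x => x i * φ x) x = x i * partialDeriv i φ x + φ x := by
  have h1 : HasFDerivAt (fun x : Euc n => x i) (EuclideanSpace.proj i : Euc n →L[ℝ] ℝ) x :=
    (EuclideanSpace.proj i : Euc n →L[ℝ] ℝ).hasFDerivAt
  have h2 := h1.mul (hφ.differentiableAt x).hasFDerivAt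
  change fderiv ℝ ((fun x : Euc n => x i) * φ) x (EuclideanSpace.single i 1) = _
  rw [h2.fderiv]
  simp [partialDeriv]

/-- The Poincaré inequality for test functions on a bounded set. -/
theorem norm_le_of_mem_testGraph (hΩ : IsOpen Ω) {R : ℝ} (hR : 0 ≤ R) {i : Fin n}
    (hΩR : ∀ x ∈ Ω, |x i| ≤ R) {z : L2 Ω × L2Vec Ω} (hz : z ∈ testGraph Ω) :
    ‖z.1‖ ≤ 2 * R * ‖z.2 i‖ := by
  obtain ⟨φ, hφ, h1, h2⟩ := hz
  have hc := hφ.smooth.continuous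
  have hd := hφ.continuous_partialDeriv i
  have hx : Continuous fun x : Euc n => x i := by fun_prop
  have i1 : IntegrableOn (fun x => φ x * φ x) Ω :=
    ((hc.mul hc).integrable_of_hasCompactSupport hφ.compact.mul_left).integrableOn
  have i2 : IntegrableOn (fun x => partialDeriv i φ x * partialDeriv i φ x) Ω :=
    ((hd.mul hd).integrable_of_hasCompactSupport
      (hφ.hasCompactSupport_partialDeriv i).mul_left).integrableOn
  have i3 : IntegrableOn (fun x => partialDeriv i φ x * (x i * φ x)) Ω :=
    ((hd.mul (hx.mul hc)).integrable_of_hasCompactSupport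
      (hφ.coord_mul i).compact.mul_left).integrableOn
  have n1 : ‖z.1‖ ^ 2 = ∫ x in Ω, φ x * φ x := by
    rw [← real_inner_self_eq_norm_sq, L2.inner_eq_integral]
    exact integral_congr_ae (h1.mono fun x hx => by simp only [hx])
  have n2 : ‖z.2 i‖ ^ 2 = ∫ x in Ω, partialDeriv i φ x * partialDeriv i φ x := by
    rw [← real_inner_self_eq_norm_sq, L2.inner_eq_integral]
    exact integral_congr_ae ((h2 i).mono fun x hx => by simp only [hx])
  -- Testing with `x i * φ` yields `‖φ‖² = -2 ∫ x i * φ * ∂ᵢφ`; Young's inequality in `h4` then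
  -- absorbs half of `‖φ‖²`, whence the constant `2 * R`.
  have key := hφ.integral_mul_partialDeriv (hφ.coord_mul i) i
  have h3 : ∫ x in Ω, φ x * partialDeriv i (fun x => x i * φ x) x =
      (∫ x in Ω, partialDeriv i φ x * (x i * φ x)) + ∫ x in Ω, φ x * φ x := by
    rw [← integral_add i3 i1]
    refine integral_congr_ae (.of_forall fun x => ?_)
    simp only [hφ.partialDeriv_coord_mul i x]
    ring
  rw [h3, ← n1] at key
  have h4 : -2 * ∫ x in Ω, partialDeriv i φ x * (x i * φ x) ≤
      (1 / 2) * ‖z.1‖ ^ 2 + 2 * R ^ 2 * ‖z.2 i‖ ^ 2 := by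
    rw [n1, n2, ← integral_const_mul, ← integral_const_mul, ← integral_const_mul,
      ← integral_add (i1.const_mul _) (i2.const_mul _)]
    refine setIntegral_mono_on (i3.const_mul _) ((i1.const_mul _).add (i2.const_mul _))
      hΩ.measurableSet fun x hx => ?_
    have h5 : x i ^ 2 ≤ R ^ 2 := sq_le_sq' (abs_le.mp (hΩR x hx)).1 (abs_le.mp (hΩR x hx)).2
    have h6 := mul_le_mul_of_nonneg_right h5 (sq_nonneg (partialDeriv i φ x))
    nlinarith [sq_nonneg (φ x + 2 * (x i * partialDeriv i φ x))]
  refine abs_le_of_sq_le_sq' ?_ (by positivity) |>.2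
  nlinarith

/-- The Poincaré inequality on `V`. -/
theorem exists_poincare (hΩ : IsOpen Ω) (hb : Bornology.IsBounded Ω) (hn : 0 < n) :
    ∃ C : ℝ, ∀ v ∈ V Ω, ‖v‖ ≤ C * ‖gradVec Ω v‖ := by
  obtain ⟨R, hR, hΩR⟩ := hb.exists_pos_norm_le
  have h1 : ∀ x ∈ Ω, |x ⟨0, hn⟩| ≤ R := fun x hx =>
    (PiLp.norm_apply_le x _).trans (hΩR x hx)
  have h2 : ∀ z ∈ (testGraph Ω).topologicalClosure, ‖z.1‖ ≤ 2 * R * ‖z.2‖ := by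
    intro z hz
    have hcl : IsClosed {z : L2 Ω × L2Vec Ω | ‖z.1‖ ≤ 2 * R * ‖z.2‖} :=
      isClosed_le (by fun_prop) (by fun_prop)
    refine closure_minimal (fun z hz => ?_) hcl hz
    exact (norm_le_of_mem_testGraph hΩ hR.le h1 hz).trans
      (mul_le_mul_of_nonneg_left (PiLp.norm_apply_le z.2 _) (by positivity))
  refine ⟨2 * R, fun v hv => abs_le_of_sq_le_sq' ?_ (by positivity) |>.2⟩
  rw [mul_pow, PiLp.norm_sq_eq_of_L2, PiLp.norm_sq_eq_of_L2, Finset.mul_sum]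
  refine Finset.sum_le_sum fun i _ => ?_
  rw [← mul_pow]
  exact pow_le_pow_left₀ (norm_nonneg _)
    (h2 _ (mem_closure_testGraph_of_mem_H10 hΩ (hv.1 i))) 2

end Poincare

/-! ### Finite element spaces and the constants `C0h` and `kappa` -/

section Discrete

variable {n : ℕ} {Ω : Set (Euc n)} {T : Geometry.SimplicialComplex ℝ (Euc n)}

theorem IsMesh.isBounded (hT : IsMesh Ω T) : Bornology.IsBounded Ω := by
  refine Bornology.IsBounded.subset ?_ (subset_closure.trans hT.closure_eq.subset)
  exact (Bornology.isBounded_biUnion hT.finite).mpr fun s _ =>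
    isBounded_convexHull.mpr s.finite_toSet.isBounded

theorem IsMesh.exists_cell (hT : IsMesh Ω T) {x : Euc n} (hx : x ∈ Ω) :
    ∃ s ∈ cells T, x ∈ convexHull ℝ (s : Set (Euc n)) := by
  have h : x ∈ T.space := hT.closure_eq ▸ subset_closure hx
  obtain ⟨s, hs, hxs⟩ := Geometry.SimplicialComplex.mem_space_iff.mp h
  obtain ⟨t, ht, hst, hcard⟩ := hT.pure s hs
  exact ⟨t, ⟨ht, hcard⟩, convexHull_mono (Finset.coe_subset.mpr hst) hxs⟩

/-- The cells cover `Ω`, so the polynomials on them determine the function. Working with the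
relation `R` of functions and compatible polynomial families avoids showing that these polynomials
are unique. -/
theorem finiteDimensional_Xh (hΩ : IsOpen Ω) (hT : IsMesh Ω T) (d : ℕ) :
    FiniteDimensional ℝ (Xh Ω T d) := by
  have hfin : Finite (cells T) := (hT.finite.subset fun s hs => hs.1).to_subtype
  let R : Submodule ℝ (L2 Ω × (cells T → Poly n d)) :=
    { carrier := {z | ∀ s : cells T, ∀ᵐ x ∂volume.restrict Ω,
        x ∈ convexHull ℝ (s.1 : Set (Euc n)) → z.1 x = pval (z.2 s) x}
      zero_mem' := fun s => by
        filter_upwards [Lp.coeFn_zero ℝ 2 (volume.restrict Ω)] with x hx _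
        simpa [pval] using hx
      add_mem' := by
        intro z w hz hw s
        filter_upwards [Lp.coeFn_add z.1 w.1, hz s, hw s] with x hx hx1 hx2 hxs
        change (z.1 + w.1 : L2 Ω) x = _
        rw [hx, Pi.add_apply, hx1 hxs, hx2 hxs]
        simp [pval]
      smul_mem' := by
        intro c z hz s
        filter_upwards [Lp.coeFn_smul c z.1, hz s] with x hx hx1 hxs
        simp [hx, pval, hx1 hxs, MvPolynomial.smul_eval] }
  have hinj : Function.Injective ((LinearMap.snd ℝ (L2 Ω) (cells T → Poly n d)) ∘ₗ R.subtype) := by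
    refine (injective_iff_map_eq_zero _).mpr ?_
    rintro ⟨⟨u, q⟩, h⟩ hq
    have hq' : q = 0 := hq
    subst hq'
    have hu : u = 0 := by
      refine Lp.eq_zero_iff_ae_eq_zero.mpr ?_
      filter_upwards [ae_all_iff.mpr h, ae_restrict_mem hΩ.measurableSet] with x hx hxΩ
      obtain ⟨s, hs, hxs⟩ := hT.exists_cell hxΩ
      simpa [pval] using hx ⟨s, hs⟩ hxs
    subst hu
    rfl
  have : FiniteDimensional ℝ R := FiniteDimensional.of_injective _ hinj
  refine Submodule.finiteDimensional_of_le (S₂ := R.map (LinearMap.fst ℝ _ _)) fun u hu => ?_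
  choose q hq h using hu
  exact ⟨(u, fun s => ⟨q s.1 s.2, hq s.1 s.2⟩), fun s => h s.1 s.2, rfl⟩

theorem finiteDimensional_vec (S : Submodule ℝ (L2 Ω)) [FiniteDimensional ℝ S] :
    FiniteDimensional ℝ (vec S : Submodule ℝ (L2Vec Ω)) := by
  let L : (vec S : Submodule ℝ (L2Vec Ω)) →ₗ[ℝ] (Fin n → S) :=
    { toFun := fun u i => ⟨u.1 i, u.2 i⟩
      map_add' := fun _ _ => rfl
      map_smul' := fun _ _ => rfl }
  refine FiniteDimensional.of_injective L fun u v h => Subtype.ext ?_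
  ext1 i
  exact congrArg Subtype.val (congrFun h i)

theorem norm_sub_le_of_C0h_ne_top {d : ℕ} (hC : C0h Ω T d ≠ ⊤) {u w : L2Vec Ω} (hu : u ∈ V Ω)
    (hw : IsL2Proj (vec (Xh Ω T d)) u w) :
    ‖u - w‖ ≤ (C0h Ω T d).toReal * ‖gradVec Ω u‖ := by
  have key : ‖u - w‖ₑ ≤ C0h Ω T d * ‖gradVec Ω u‖ₑ := by
    -- The infimum is itself admissible: divide by the gradient norm, or, if that is zero, use any
    -- admissible constant.
    rcases eq_or_ne ‖gradVec Ω u‖ₑ 0 with h0 | h0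
    · obtain ⟨C, hC, -⟩ := sInf_lt_iff.mp hC.lt_top
      have := hC u hu w hw
      rwa [h0, mul_zero] at this ⊢
    · rw [← ENNReal.div_le_iff h0 enorm_ne_top]
      exact le_sInf fun C hC => (ENNReal.div_le_iff h0 enorm_ne_top).mpr (hC u hu w hw)
  have := ENNReal.toReal_mono (ENNReal.mul_ne_top hC enorm_ne_top) key
  simpa using this

theorem exists_norm_sub_le_of_kappa_ne_top {r : ℕ} (hκ : kappa Ω T r ≠ ⊤) {f : L2Vec Ω}
    (hf : f ∈ vec (Xh Ω T (r - 1))) (hf0 : f ≠ 0) {ε : ℝ} (hε : 0 < ε) :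
    ∃ p : L2Ten Ω, Equilibrated Ω T r p f ∧ ∃ v ∈ Vh Ω T r,
      ‖p - gradVec Ω v‖ ≤ ((kappa Ω T r).toReal + ε) * ‖f‖ := by
  have h1 : (⨅ (p : L2Ten Ω) (_ : p ∈ RThTen Ω T (r - 1)) (_ : Equilibrated Ω T r p f)
      (v : L2Vec Ω) (_ : v ∈ Vh Ω T r), ‖p - gradVec Ω v‖ₑ / ‖f‖ₑ) <
      kappa Ω T r + ENNReal.ofReal ε := by
    refine lt_of_le_of_lt ?_ (ENNReal.lt_add_right hκ (by simpa using hε))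
    exact le_iSup_of_le f (le_iSup_of_le hf (le_iSup_of_le hf0 le_rfl))
  simp only [iInf_lt_iff] at h1
  obtain ⟨p, -, hp, v, hv, hlt⟩ := h1
  refine ⟨p, hp, v, hv, ?_⟩
  rw [ENNReal.div_lt_iff (Or.inl (by simpa using hf0)) (Or.inl enorm_ne_top)] at hlt
  have := ENNReal.toReal_mono (ENNReal.mul_ne_top (by finiteness) enorm_ne_top) hlt.le
  rw [ENNReal.toReal_mul, ENNReal.toReal_add hκ ENNReal.ofReal_ne_top,
    ENNReal.toReal_ofReal hε.le] at this
  simpa using this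

end Discrete

/-- Because `x ↦ x / (1 + D x)` is increasing, an upper bound `ν` for the discrete eigenvalue `a`
suffices. -/
theorem div_one_add_mul_le {a c s : ℝ≥0∞} {ν D : ℝ} {t : ℝ≥0} (hD : 0 ≤ D) (hν : 0 ≤ ν)
    (hc : c = ENNReal.ofReal D) (hs : s = t) (ha : a ≤ ENNReal.ofReal ν)
    (h : ν ≤ t * (1 + D * ν)) : a / (1 + c * a) ≤ s := by
  have hfin : a ≠ ⊤ := ne_top_of_le_ne_top ENNReal.ofReal_ne_top ha
  lift a to ℝ≥0 using hfin
  subst hc hs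
  have ha' : (a : ℝ) ≤ ν := by
    have := ENNReal.toReal_mono ENNReal.ofReal_ne_top ha
    rwa [ENNReal.toReal_ofReal hν, ENNReal.coe_toReal] at this
  refine ENNReal.div_le_of_le_mul ?_
  rw [ENNReal.ofReal, ← ENNReal.coe_mul, ← ENNReal.coe_one, ← ENNReal.coe_add, ← ENNReal.coe_mul,
    ENNReal.coe_le_coe, ← NNReal.coe_le_coe]
  push_cast
  rw [Real.coe_toNNReal D hD]
  have ha0 : (0 : ℝ) ≤ a := a.2
  have hpos : 0 < 1 + D * ν := by positivity
  refine le_of_mul_le_mul_right ?_ hpos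
  calc (a : ℝ) * (1 + D * ν) ≤ ν * (1 + D * a) := by linarith
    _ ≤ t * (1 + D * ν) * (1 + D * a) := by gcongr
    _ = _ := by ring

end

end StokesFEM

/-! ### Main theorem -/

open StokesFEM in
theorem mainTheorem4 (n : ℕ) (hn : n = 2 ∨ n = 3) (Ω : Set (EuclideanSpace ℝ (Fin n)))
    (hΩ : IsOpen Ω) (hΩc : IsConnected Ω)
    (T : Geometry.SimplicialComplex ℝ (EuclideanSpace ℝ (Fin n))) (hT : IsMesh Ω T)
    (r : ℕ) (hr : 1 ≤ r) (k : ℕ) (hk : 1 ≤ k) (hkn : k ≤ Module.finrank ℝ (Vh Ω T r)) :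
    eigenvalue (Vh Ω T r) k ≠ ⊤ ∧
    eigenvalue (Vh Ω T r) k / (1 + Ch Ω T r ^ 2 * eigenvalue (Vh Ω T r) k)
      ≤ eigenvalue (V Ω) k := by
  obtain ⟨C, hC⟩ := exists_poincare hΩ hT.isBounded (by omega)
  -- `Module.finrank` is zero in infinite dimension, so `1 ≤ k ≤ finrank` forces finite dimension.
  have : FiniteDimensional ℝ (Vh Ω T r) := Module.finite_of_finrank_pos (by omega)
  let G := gradLin hΩ (V Ω) V_le_vec_H1
  obtain ⟨ν, e, μ, hν, he, hμν, hμ, hmin⟩ := exists_eigenvectors_and_lower_bound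
    (Vh_le_V (Ω := Ω) T r) G (fun v => hC v v.2) hk hkn
  have hle : eigenvalue (Vh Ω T r) k ≤ ENNReal.ofReal ν :=
    iInf₂_le (ν.toNNReal) ⟨fun i => e i, he, fun i =>
      ⟨μ i, (hμν i).trans (Real.le_coe_toNNReal ν), (e i).2, he.ne_zero i,
        fun v hv => hμ i ⟨v, hv⟩⟩⟩
  refine ⟨ne_top_of_le_ne_top ENNReal.ofReal_ne_top hle, ?_⟩
  -- If a constant is infinite, the quotient is zero: either its numerator vanishes or its
  -- denominator is `⊤`.
  by_cases hCh : C0h Ω T (r - 1) = ⊤ ∨ kappa Ω T r = ⊤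
  · have hCh' : Ch Ω T r = ⊤ := by
      rcases hCh with h | h <;> simp [Ch, h]
    rcases eq_or_ne (eigenvalue (Vh Ω T r) k) 0 with h0 | h0
    · simp [h0]
    · simp [hCh', ENNReal.top_mul h0]
  obtain ⟨h0, hκ⟩ := not_or.mp hCh
  set c := (C0h Ω T (r - 1)).toReal with hc
  set κ := (kappa Ω T r).toReal with hκ'
  have hCh2 : Ch Ω T r ^ 2 = ENNReal.ofReal (c ^ 2 + κ ^ 2) := by
    rw [Ch, ← ENNReal.rpow_natCast, ← ENNReal.rpow_mul,
      ENNReal.ofReal_add (sq_nonneg _) (sq_nonneg _),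
      ENNReal.ofReal_pow ENNReal.toReal_nonneg, ENNReal.ofReal_pow ENNReal.toReal_nonneg,
      ENNReal.ofReal_toReal h0, ENNReal.ofReal_toReal hκ]
    norm_num
  have := finiteDimensional_Xh hΩ hT (r - 1)
  have := finiteDimensional_vec (Xh Ω T (r - 1))
  have hD : ∀ e : V Ω, (∀ v : Vh Ω T r, ⟪G ⟨v, Vh_le_V T r v.2⟩, G e⟫_ℝ = 0) →
      ‖e‖ ^ 2 ≤ (c ^ 2 + κ ^ 2) * ‖G e‖ ^ 2 := by
    intro e he
    refine norm_sq_le_of_energy_orthogonal G ((Vh Ω T r).submoduleOf (V Ω))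
      (vec (Xh Ω T (r - 1))) (fun v => hC v v.2)
      ENNReal.toReal_nonneg (fun v => ?_) (fun f hf ε hε => ?_) (fun v hv => he ⟨v, hv⟩)
    · exact norm_sub_le_of_C0h_ne_top h0 v.2 ⟨Submodule.starProjection_apply_mem _ _,
        fun w hw => Submodule.starProjection_inner_eq_zero _ _ hw⟩
    -- The supremum in `kappa` omits the zero load, for which the zero pair serves.
    · rcases eq_or_ne f 0 with rfl | hf0
      · exact ⟨0, fun v => by simp, 0, zero_mem _, by simp⟩
      · obtain ⟨p, hp, v, hv, hpv⟩ := exists_norm_sub_le_of_kappa_ne_top hκ hf hf0 hε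
        exact ⟨p, fun w => hp.inner_gradVec hΩ w.2, ⟨v, Vh_le_V T r hv⟩, hv, hpv⟩
  refine le_iInf₂ fun s hs => ?_
  obtain ⟨u, hlin, hu⟩ := hs
  choose lam hlam hu using hu
  refine div_one_add_mul_le (by positivity) hν hCh2 rfl hle ?_
  exact hmin _ (by positivity) hD (fun i => ⟨u i, (hu i).1⟩) lam s hlin hlam
    (fun i v => (hu i).2.2 v v.2)
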